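/- **Theorem 3.5 (Partial semigroup property of Caputo fractional differential operators).** Let $-\infty<a<b<\infty$; all functions are real-valued on $[a,b]$, and derivatives at $a$ and $b$ are one-sided. For $\alpha>0$ and $g\in C[a,b]$ put $J_a^\alpha g(x)=\frac1{\Gamma(\alpha)}\int_a^x(x-t)^{\alpha-1}g(t)\,dt$, and let $J_a^0$ be the identity. For $\alpha>0$, $m=\lceil\alpha\rceil$ and $f\in C^{m-1}[a,b]$ let $T_{m-1}[f;a](t)=\sum_{k=0}^{m-1}\frac{f^{(k)}(a)}{k!}(t-a)^k$. Such an $f$ is called *continuously Caputo $\alpha$-differentiable* if the Caputo derivative ${}^{C}\!D_a^\alpha f:=D^mJ_a^{m-\alpha}\bigl(f-T_{m-1}[f;a]\bigr)$ exists and is continuous on $[a,b]$, i.e. if $J_a^{m-\alpha}(f-T_{m-1}[f;a])\in C^m[a,b]$. **I.** Let $\alpha>0$ and let $f\in C^{\lceil\alpha\rceil-1}[a,b]$ be continuously Caputo $\alpha$-differentiable. Then for every $0<\beta<\alpha$: (i) $f$ is continuously Caputo $\beta$-differentiable, with continuous derivative $f_1:={}^{C}\!D_a^\beta f\in C[a,b]$;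 furthermore, if $\beta\notin\mathbb N$, then $({}^{C}\!D_a^\beta f)(a)=0$. (ii) For every $0<\gamma\le1$ with $\beta+\gamma\le\alpha$ and $\lceil\beta+\gamma\rceil-\lfloor\beta\rfloor=1$, the function $f_1$ is continuously Caputo $\gamma$-differentiable and ${}^{C}\!D_a^\gamma f_1={}^{C}\!D_a^{\beta+\gamma}f$ on $[a,b]$, i.e. ${}^{C}\!D_a^\gamma\,{}^{C}\!D_a^\beta f={}^{C}\!D_a^{\beta+\gamma}f$. **II.** Conversely, let $\beta>0$ and $0<\gamma\le1$ be such that $\lceil\beta+\gamma\rceil-\lfloor\beta\rfloor=1$. Assume that $h\in C^{\lceil\beta\rceil-1}[a,b]$ is continuously Caputo $\beta$-differentiable, that $h_1:={}^{C}\!D_a^\beta h$ is continuously Caputo $\gamma$-differentiable, and that $h_1(a)=0$ if $\beta\notin\mathbb N$. Then $h$ is continuously Caputo $(\beta+\gamma)$-differentiable and ${}^{C}\!D_a^\gamma h_1={}^{C}\!D_a^{\beta+\gamma}h$ on $[a,b]$, i.e. ${}^{C}\!D_a^\gamma({}^{C}\!D_a^\beta h)={}^{C}\!D_a^{\beta+\gamma}h$.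 -/

import Mathlib

noncomputable section

/-- The Riemann-Liouville fractional integral `J_a^α f` of order `α ≥ 0` with base point `a`;
`J_a^0` is the identity. -/
def rlIntegral (a α : ℝ) (f : ℝ → ℝ) (x : ℝ) : ℝ :=
  open Classical in
  if α = 0 then f x
  else 1 / Real.Gamma α * ∫ t in a..x, (x - t) ^ (α - 1) * f t

/-- The Riemann-Liouville derivative `D^m J_a^{m-α} f` on `[a,b]`, with `m = ⌈α⌉`
(one-sided derivatives at the endpoints). -/
def rlDeriv (a b α : ℝ) (f : ℝ → ℝ) : ℝ → ℝ :=
  iteratedDerivWithin ⌈α⌉₊ (rlIntegral a ((⌈α⌉₊ : ℝ) - α) f) (Set.Icc a b)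

/-- `f` is continuously Riemann-Liouville `α`-differentiable on `[a,b]`: `f ∈ C[a,b]`, and
`D^m J_a^{m-α} f` exists and is continuous on `[a,b]`, that is, `J_a^{m-α} f ∈ C^m[a,b]`,
with `m = ⌈α⌉`. -/
def ContRLDifferentiable (a b α : ℝ) (f : ℝ → ℝ) : Prop :=
  ContinuousOn f (Set.Icc a b) ∧
    ContDiffOn ℝ (⌈α⌉₊ : ℕ) (rlIntegral a ((⌈α⌉₊ : ℝ) - α) f) (Set.Icc a b)

/-- The remainder `f - T_{m-1}[f;a]`, where `m = ⌈α⌉` and `T_{m-1}[f;a]` is the Taylor polynomial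
of `f` of degree `m - 1` at `a` (for `α > 0`, so that `m ≥ 1`). -/
def caputoRemainder (a b α : ℝ) (f : ℝ → ℝ) (t : ℝ) : ℝ :=
  f t - taylorWithinEval f (⌈α⌉₊ - 1) (Set.Icc a b) a t

/-- The Caputo derivative of order `α ≥ 0` on `[a,b]`: the Riemann-Liouville derivative of
`f - T_{m-1}[f;a]` for `α > 0`, and `f` itself for `α = 0`. -/
def caputoDeriv (a b α : ℝ) (f : ℝ → ℝ) : ℝ → ℝ :=
  open Classical in
  if α = 0 then f else rlDeriv a b α (caputoRemainder a b α f)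

/-- `f` is continuously Caputo `α`-differentiable on `[a,b]` (for `α > 0`): `f ∈ C^{⌈α⌉-1}[a,b]`,
and the Caputo derivative of order `α` of `f` exists and is continuous on `[a,b]`. -/
def ContCaputoDifferentiable (a b α : ℝ) (f : ℝ → ℝ) : Prop :=
  ContDiffOn ℝ (⌈α⌉₊ - 1 : ℕ) f (Set.Icc a b) ∧
    ContRLDifferentiable a b α (caputoRemainder a b α f)

end

/-!
The fractional integrals form a semigroup `J_a^α J_a^β = J_a^{α+β}` on continuous functions: this
is Dirichlet's formula on a triangle together with the beta integral. Hence `J_a^α` is injective,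
and a continuous `g` is the Caputo derivative of order `α` of `f` exactly when
`f = ∑_{j<m} c_j (x-a)^j / j! + J_a^α g` with `m = ⌈α⌉`. In this form the composition of Caputo
derivatives is bookkeeping of constants. Integrating a representation of order `γ` exactly `n`
times gives one of order `n + γ`. For noninteger `β` and `⌈β + γ⌉ = ⌈β⌉`, passing from `β` to
`β + γ` turns the derivative `J_a^γ g` into `g`, and among the `h` with `γ`-th derivative `g` the
function `J_a^γ g` is the one with `h(a) = 0`.
-/

open Set MeasureTheory

section Triangle

variable {E : Type*} [NormedAddCommGroup E] {a x : ℝ} {f : ℝ → ℝ → E}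

/-- The triangle `a < s < t ≤ x` in the `(t, s)`-plane, the domain of integration of iterated
integrals with a variable upper limit. -/
def triangle (a x : ℝ) : Set (ℝ × ℝ) :=
  {p | a < p.2 ∧ p.2 < p.1 ∧ p.1 ≤ x}

theorem measurableSet_triangle (a x : ℝ) : MeasurableSet (triangle a x) :=
  (measurableSet_lt measurable_const measurable_snd).inter
    ((measurableSet_lt measurable_snd measurable_fst).inter
      (measurableSet_le measurable_fst measurable_const))

theorem indicator_triangle_eq_indicator_Ioo (a x : ℝ) (F : ℝ × ℝ → E) (t s : ℝ) :
    (triangle a x).indicator F (t, s) =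
      (Ioo a x).indicator (fun s => (Ioc s x).indicator (fun t => F (t, s)) t) s := by
  simp only [indicator, triangle, mem_ofPred_eq, mem_Ioo, mem_Ioc]
  grind

theorem indicator_triangle_eq_indicator_Ioc (a x : ℝ) (F : ℝ × ℝ → E) (t s : ℝ) :
    (triangle a x).indicator F (t, s) =
      (Ioc a x).indicator (fun t => (Ioo a t).indicator (fun s => F (t, s)) s) t := by
  simp only [indicator, triangle, mem_ofPred_eq, mem_Ioo, mem_Ioc]
  grind

theorem integral_indicator_triangle_left [NormedSpace ℝ E] (f : ℝ → ℝ → E) (s : ℝ) :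
    ∫ t, (triangle a x).indicator f.uncurry (t, s) =
      (Ioo a x).indicator (fun s => ∫ t in s..x, f t s) s := by
  simp only [indicator_triangle_eq_indicator_Ioo]
  by_cases hs : s ∈ Ioo a x
  · simp [hs, integral_indicator measurableSet_Ioc, intervalIntegral.integral_of_le hs.2.le]
  · simp [hs]

theorem integral_indicator_triangle_right [NormedSpace ℝ E] (f : ℝ → ℝ → E) (t : ℝ) :
    ∫ s, (triangle a x).indicator f.uncurry (t, s) =
      (Ioc a x).indicator (fun t => ∫ s in a..t, f t s) t := by
  simp only [indicator_triangle_eq_indicator_Ioc]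
  by_cases ht : t ∈ Ioc a x
  · simp [ht, integral_indicator measurableSet_Ioo, intervalIntegral.integral_of_le ht.1.le,
      integral_Ioc_eq_integral_Ioo]
  · simp [ht]

theorem integral_integral_triangle_swap [NormedSpace ℝ E] (hax : a ≤ x)
    (hf : IntegrableOn f.uncurry (triangle a x)) :
    ∫ t in a..x, ∫ s in a..t, f t s = ∫ s in a..x, ∫ t in s..x, f t s := by
  have hswap := integral_integral_swap (f := fun t s => (triangle a x).indicator f.uncurry (t, s))
    ((integrable_indicator_iff (measurableSet_triangle a x)).2 hf)
  simp only [integral_indicator_triangle_left, integral_indicator_triangle_right] at hswap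
  rwa [integral_indicator measurableSet_Ioc, integral_indicator measurableSet_Ioo,
    ← integral_Ioc_eq_integral_Ioo, ← intervalIntegral.integral_of_le hax,
    ← intervalIntegral.integral_of_le hax] at hswap

theorem integrableOn_triangle (hax : a ≤ x)
    (hmeas : AEStronglyMeasurable f.uncurry (volume.restrict (triangle a x)))
    (hslice : ∀ s ∈ Ioo a x, IntervalIntegrable (fun t => f t s) volume s x)
    (hnorm : IntervalIntegrable (fun s => ∫ t in s..x, ‖f t s‖) volume a x) :
    IntegrableOn f.uncurry (triangle a x) := by
  rw [← integrable_indicator_iff (measurableSet_triangle a x)]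
  refine (integrable_prod_iff'
    ((aestronglyMeasurable_indicator_iff (measurableSet_triangle a x)).2 hmeas)).2
      ⟨.of_forall fun s => ?_, ?_⟩
  · simp only [indicator_triangle_eq_indicator_Ioo]
    by_cases hs : s ∈ Ioo a x
    · simp only [hs, indicator_of_mem]
      exact (integrable_indicator_iff measurableSet_Ioc).2
        ((intervalIntegrable_iff_integrableOn_Ioc_of_le hs.2.le).1 (hslice s hs))
    · simp [hs]
  · simp only [norm_indicator_eq_indicator_norm]
    have h := integral_indicator_triangle_left (a := a) (x := x) fun t s => ‖f t s‖
    simp only [Function.uncurry_def] at h ⊢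
    simp only [h]
    exact (integrable_indicator_iff measurableSet_Ioo).2
      ((intervalIntegrable_iff_integrableOn_Ioo_of_le hax).1 hnorm)

end Triangle

section BetaIntegral

variable {α β s x : ℝ}

theorem integral_rpow_mul_sub_rpow (hα : 0 < α) (hβ : 0 < β) (hx : 0 < x) :
    ∫ t in (0 : ℝ)..x, t ^ (α - 1) * (x - t) ^ (β - 1) =
      x ^ (α + β - 1) * ProbabilityTheory.beta α β := by
  apply Complex.ofReal_injective
  calc ((∫ t in (0 : ℝ)..x, t ^ (α - 1) * (x - t) ^ (β - 1) : ℝ) : ℂ)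
      = ∫ t in (0 : ℝ)..x, (t : ℂ) ^ ((α : ℂ) - 1) * ((x : ℂ) - t) ^ ((β : ℂ) - 1) := by
        rw [← intervalIntegral.integral_ofReal]
        refine intervalIntegral.integral_congr fun t ht => ?_
        rw [uIcc_of_le hx.le] at ht
        rw [Complex.ofReal_mul, Complex.ofReal_cpow ht.1, Complex.ofReal_cpow (sub_nonneg.2 ht.2)]
        push_cast
        rfl
    _ = (x : ℂ) ^ ((α : ℂ) + β - 1) * (Complex.Gamma α * Complex.Gamma β /
          Complex.Gamma (α + β)) := by
        rw [Complex.betaIntegral_scaled α β hx,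
          Complex.betaIntegral_eq_Gamma_mul_div _ _ (by simpa) (by simpa)]
    _ = ((x ^ (α + β - 1) * ProbabilityTheory.beta α β : ℝ) : ℂ) := by
        rw [← Complex.ofReal_add, Complex.Gamma_ofReal, Complex.Gamma_ofReal,
          Complex.Gamma_ofReal, Complex.ofReal_mul, Complex.ofReal_cpow hx.le,
          ProbabilityTheory.beta]
        push_cast
        rfl

theorem integral_sub_rpow_mul_sub_rpow (hα : 0 < α) (hβ : 0 < β) (hs : s < x) :
    ∫ t in s..x, (x - t) ^ (α - 1) * (t - s) ^ (β - 1) =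
      (x - s) ^ (α + β - 1) * ProbabilityTheory.beta α β := by
  have h := intervalIntegral.integral_comp_sub_left (a := s) (b := x)
    (fun t => t ^ (α - 1) * (x - s - t) ^ (β - 1)) x
  simp only [sub_self, sub_sub_sub_cancel_left] at h
  rw [h, integral_rpow_mul_sub_rpow hα hβ (sub_pos.2 hs)]

theorem intervalIntegrable_sub_rpow_mul_sub_rpow (hα : 0 < α) (hβ : 0 < β) (hs : s < x) :
    IntervalIntegrable (fun t => (x - t) ^ (α - 1) * (t - s) ^ (β - 1)) volume s x := by
  apply intervalIntegral.intervalIntegrable_of_integral_ne_zero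
  rw [integral_sub_rpow_mul_sub_rpow hα hβ hs]
  exact (mul_pos (Real.rpow_pos_of_pos (sub_pos.2 hs) _) (ProbabilityTheory.beta_pos hα hβ)).ne'

theorem intervalIntegrable_sub_rpow {a r : ℝ} (hr : -1 < r) :
    IntervalIntegrable (fun t => (x - t) ^ r) volume a x := by
  simpa using (intervalIntegral.intervalIntegrable_rpow' (a := x - a) (b := 0) hr).comp_sub_left x

end BetaIntegral

section RLIntegral

variable {a b α β x : ℝ} {f g : ℝ → ℝ}

theorem rlIntegral_zero (a : ℝ) (f : ℝ → ℝ) : rlIntegral a 0 f = f := by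
  funext x
  simp [rlIntegral]

theorem rlIntegral_of_pos (hα : 0 < α) (a : ℝ) (f : ℝ → ℝ) (x : ℝ) :
    rlIntegral a α f x = 1 / Real.Gamma α * ∫ t in a..x, (x - t) ^ (α - 1) * f t := by
  simp [rlIntegral, hα.ne']

theorem rlIntegral_one (a : ℝ) (f : ℝ → ℝ) (x : ℝ) : rlIntegral a 1 f x = ∫ t in a..x, f t := by
  simp [rlIntegral]

theorem rlIntegral_self (hα : α ≠ 0) (a : ℝ) (f : ℝ → ℝ) : rlIntegral a α f a = 0 := by
  simp [rlIntegral, hα]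

theorem rlIntegral_self_of_eq_zero (hf : f a = 0) (α : ℝ) : rlIntegral a α f a = 0 := by
  by_cases hα : α = 0
  · rw [hα, rlIntegral_zero, hf]
  · exact rlIntegral_self hα a f

theorem rlIntegral_congr (h : EqOn f g (Icc a b)) (α : ℝ) :
    EqOn (rlIntegral a α f) (rlIntegral a α g) (Icc a b) := by
  intro x hx
  by_cases hα : α = 0
  · simpa only [hα, rlIntegral_zero] using h hx
  · simp only [rlIntegral, if_neg hα]
    congr 1
    refine intervalIntegral.integral_congr fun t ht => ?_
    rw [uIcc_of_le hx.1] at ht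
    simp only [h (Icc_subset_Icc_right hx.2 ht)]

theorem rlIntegral_natCast_const (a : ℝ) (n : ℕ) (c x : ℝ) :
    rlIntegral a n (fun _ => c) x = c / n.factorial * (x - a) ^ n := by
  rcases n with _ | n
  · simp [rlIntegral_zero]
  · have hpow (t : ℝ) : (x - t) ^ (((n + 1 : ℕ) : ℝ) - 1) = (x - t) ^ n := by
      rw [← Real.rpow_natCast, Nat.cast_add_one, add_sub_cancel_right]
    rw [rlIntegral_of_pos (by positivity), Nat.cast_add_one, Real.Gamma_nat_eq_factorial,
      Nat.factorial_succ, ← Nat.cast_add_one]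
    simp only [hpow]
    rw [intervalIntegral.integral_mul_const,
      intervalIntegral.integral_comp_sub_left (fun t => t ^ n) x, integral_pow]
    push_cast
    field_simp
    simp

theorem intervalIntegrable_sub_rpow_mul (hα : 0 < α) (hf : ContinuousOn f (Icc a b))
    (hx : x ∈ Icc a b) : IntervalIntegrable (fun t => (x - t) ^ (α - 1) * f t) volume a x := by
  refine (intervalIntegrable_sub_rpow (by linarith)).mul_continuousOn ?_
  rw [uIcc_of_le hx.1]
  exact hf.mono (Icc_subset_Icc_right hx.2)

theorem rlIntegral_add (hα : 0 ≤ α) (hf : ContinuousOn f (Icc a b))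
    (hg : ContinuousOn g (Icc a b)) (hx : x ∈ Icc a b) :
    rlIntegral a α (fun t => f t + g t) x = rlIntegral a α f x + rlIntegral a α g x := by
  rcases hα.eq_or_lt with rfl | hα
  · simp only [rlIntegral_zero]
  · simp only [rlIntegral_of_pos hα, mul_add]
    rw [intervalIntegral.integral_add (intervalIntegrable_sub_rpow_mul hα hf hx)
      (intervalIntegrable_sub_rpow_mul hα hg hx), mul_add]

theorem exists_boundedContinuous_eqOn_Icc (hab : a ≤ b) (hf : ContinuousOn f (Icc a b)) :
    ∃ g : BoundedContinuousFunction ℝ ℝ, EqOn f g (Icc a b) :=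
  ⟨(BoundedContinuousFunction.mkOfCompact ⟨_, hf.domRestrict⟩).compContinuous
    ⟨projIcc a b hab, continuous_projIcc⟩, fun x hx => by simp [projIcc_of_mem hab hx]⟩

theorem rlIntegral_eq_rpow_mul (hα : 0 < α) (hx : a ≤ x) (f : ℝ → ℝ) :
    rlIntegral a α f x = (x - a) ^ α * (1 / Real.Gamma α *
      ∫ s in (0 : ℝ)..1, (1 - s) ^ (α - 1) * f ((x - a) * s + a)) := by
  rcases hx.eq_or_lt with rfl | hx
  · simp [rlIntegral_self hα.ne', Real.zero_rpow hα.ne']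
  have hxa : 0 < x - a := sub_pos.2 hx
  have hscale : ∫ s in (0 : ℝ)..1, (x - ((x - a) * s + a)) ^ (α - 1) * f ((x - a) * s + a)
      = (x - a) ^ (α - 1) * ∫ s in (0 : ℝ)..1, (1 - s) ^ (α - 1) * f ((x - a) * s + a) := by
    rw [← intervalIntegral.integral_const_mul]
    refine intervalIntegral.integral_congr fun s hs => ?_
    rw [uIcc_of_le zero_le_one] at hs
    simp only [show x - ((x - a) * s + a) = (x - a) * (1 - s) by ring]
    rw [Real.mul_rpow hxa.le (sub_nonneg.2 hs.2), mul_assoc]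
  have hsubst := intervalIntegral.integral_comp_mul_add (a := 0) (b := 1)
    (fun t => (x - t) ^ (α - 1) * f t) hxa.ne' a
  simp only [mul_zero, zero_add, mul_one, sub_add_cancel, smul_eq_mul] at hsubst
  rw [hscale, eq_comm, inv_mul_eq_iff_eq_mul₀ hxa.ne', Real.rpow_sub_one hxa.ne'] at hsubst
  rw [rlIntegral_of_pos hα, hsubst]
  field_simp

theorem continuousOn_rlIntegral (hα : 0 ≤ α) (hf : ContinuousOn f (Icc a b)) :
    ContinuousOn (rlIntegral a α f) (Icc a b) := by
  rcases hα.eq_or_lt with rfl | hα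
  · rwa [rlIntegral_zero]
  rcases lt_or_ge b a with hab | hab
  · simp [Icc_eq_empty_of_lt hab]
  obtain ⟨g, hfg⟩ := exists_boundedContinuous_eqOn_Icc hab hf
  refine ContinuousOn.congr (Continuous.continuousOn ?_) fun x hx =>
    (rlIntegral_congr hfg α hx).trans (rlIntegral_eq_rpow_mul hα hx.1 g)
  refine ((continuous_id.sub continuous_const).rpow_const fun _ => .inr hα.le).mul
    (continuous_const.mul ?_)
  refine intervalIntegral.continuous_of_dominated_interval
    (bound := fun s => (1 - s) ^ (α - 1) * ‖g‖) (fun x => ?_) (fun x => .of_forall fun s hs => ?_)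
    ((intervalIntegrable_sub_rpow (by linarith)).mul_const _) (.of_forall fun s _ => by fun_prop)
  · exact ((Measurable.pow_const (by fun_prop) _).mul
      (g.continuous.measurable.comp (by fun_prop))).aestronglyMeasurable
  · rw [uIoc_of_le zero_le_one] at hs
    have hs1 : 0 ≤ 1 - s := sub_nonneg.2 hs.2
    rw [norm_mul, Real.norm_of_nonneg (Real.rpow_nonneg hs1 _)]
    exact mul_le_mul_of_nonneg_left (g.norm_coe_le_norm _) (Real.rpow_nonneg hs1 _)

theorem integral_norm_sub_rpow_mul_sub_rpow_mul (hα : 0 < α) (hβ : 0 < β) {s : ℝ} (hs : s < x)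
    (c : ℝ) : ∫ t in s..x, ‖(x - t) ^ (α - 1) * (t - s) ^ (β - 1) * c‖ =
      (x - s) ^ (α + β - 1) * ProbabilityTheory.beta α β * ‖c‖ := by
  rw [← integral_sub_rpow_mul_sub_rpow hα hβ hs, ← intervalIntegral.integral_mul_const]
  refine intervalIntegral.integral_congr fun t ht => ?_
  rw [uIcc_of_le hs.le] at ht
  simp only [norm_mul, Real.norm_of_nonneg (Real.rpow_nonneg (sub_nonneg.2 ht.1) _),
    Real.norm_of_nonneg (Real.rpow_nonneg (sub_nonneg.2 ht.2) _)]

theorem integrableOn_triangle_sub_rpow_mul (hα : 0 < α) (hβ : 0 < β) (hx : a ≤ x)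
    (hg : Continuous g) :
    IntegrableOn (fun t s => (x - t) ^ (α - 1) * (t - s) ^ (β - 1) * g s).uncurry
      (triangle a x) := by
  refine integrableOn_triangle hx (Measurable.aestronglyMeasurable ?_)
    (fun s hs => (intervalIntegrable_sub_rpow_mul_sub_rpow hα hβ hs.2).mul_const _) ?_
  · exact ((Measurable.pow_const (by fun_prop) _).mul (Measurable.pow_const (by fun_prop) _)).mul
      (hg.measurable.comp measurable_snd)
  · have h : IntervalIntegrable (fun s => (x - s) ^ (α + β - 1) * ProbabilityTheory.beta α β *
        ‖g s‖) volume a x :=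
      ((intervalIntegrable_sub_rpow (by linarith)).mul_const _).mul_continuousOn
        hg.norm.continuousOn
    refine h.congr_uIoo fun s hs => ?_
    rw [uIoo_of_le hx] at hs
    exact (integral_norm_sub_rpow_mul_sub_rpow_mul hα hβ hs.2 (g s)).symm

theorem integral_rpow_mul_integral_rpow_mul (hα : 0 < α) (hβ : 0 < β) (hx : a ≤ x)
    (hg : Continuous g) :
    ∫ t in a..x, (x - t) ^ (α - 1) * ∫ s in a..t, (t - s) ^ (β - 1) * g s =
      ProbabilityTheory.beta α β * ∫ s in a..x, (x - s) ^ (α + β - 1) * g s := by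
  simp only [← intervalIntegral.integral_const_mul, ← mul_assoc]
  rw [integral_integral_triangle_swap hx (integrableOn_triangle_sub_rpow_mul hα hβ hx hg)]
  refine intervalIntegral.integral_congr_uIoo fun s hs => ?_
  rw [uIoo_of_le hx] at hs
  rw [intervalIntegral.integral_mul_const, integral_sub_rpow_mul_sub_rpow hα hβ hs.2,
    mul_comm (ProbabilityTheory.beta α β)]

theorem rlIntegral_rlIntegral (hα : 0 ≤ α) (hβ : 0 ≤ β) (hf : ContinuousOn f (Icc a b)) :
    EqOn (rlIntegral a α (rlIntegral a β f)) (rlIntegral a (α + β) f) (Icc a b) := by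
  intro x hx
  rcases hα.eq_or_lt with rfl | hα
  · rw [rlIntegral_zero, zero_add]
  rcases hβ.eq_or_lt with rfl | hβ
  · rw [rlIntegral_zero, add_zero]
  obtain ⟨g, hfg⟩ := exists_boundedContinuous_eqOn_Icc (hx.1.trans hx.2) hf
  rw [rlIntegral_congr (rlIntegral_congr hfg β) α hx, rlIntegral_congr hfg _ hx,
    rlIntegral_of_pos hα, rlIntegral_of_pos (add_pos hα hβ)]
  simp only [rlIntegral_of_pos hβ, mul_left_comm _ (1 / Real.Gamma β)]
  rw [intervalIntegral.integral_const_mul,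
    integral_rpow_mul_integral_rpow_mul hα hβ hx.1 g.continuous, ProbabilityTheory.beta]
  have := Real.Gamma_pos_of_pos hα
  have := Real.Gamma_pos_of_pos hβ
  field_simp

theorem hasDerivWithinAt_rlIntegral_one (hf : ContinuousOn f (Icc a b)) (hx : x ∈ Icc a b) :
    HasDerivWithinAt (rlIntegral a 1 f) (f x) (Icc a b) x := by
  obtain ⟨g, hfg⟩ := exists_boundedContinuous_eqOn_Icc (hx.1.trans hx.2) hf
  have hderiv := (g.continuous.integral_hasStrictDerivAt a x).hasDerivAt.hasDerivWithinAt
    (s := Icc a b)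
  simp only [← rlIntegral_one, ← hfg hx] at hderiv
  exact hderiv.congr_of_mem (rlIntegral_congr hfg 1) hx

theorem hasDerivWithinAt_rlIntegral_add_one (hα : 0 ≤ α) (hf : ContinuousOn f (Icc a b))
    (hx : x ∈ Icc a b) :
    HasDerivWithinAt (rlIntegral a (α + 1) f) (rlIntegral a α f x) (Icc a b) x :=
  (hasDerivWithinAt_rlIntegral_one (continuousOn_rlIntegral hα hf) hx).congr_of_mem
    (fun y hy => by rw [rlIntegral_rlIntegral zero_le_one hα hf hy, add_comm]) hx

end RLIntegral

section FracTaylor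

variable {a b α β x : ℝ} {f g : ℝ → ℝ} {c d : ℕ → ℝ}

/-- The fractional Taylor expansion `∑_{j<N} c_j (x-a)^j / j! + J_a^α g (x)` with coefficients `c`
and remainder density `g`. The monomials are written as the fractional integrals `J_a^j c_j`, so
that the calculus of `rlIntegral` applies to every term. -/
noncomputable def fracTaylor (a : ℝ) (N : ℕ) (c : ℕ → ℝ) (α : ℝ) (g : ℝ → ℝ) (x : ℝ) : ℝ :=
  ∑ j ∈ Finset.range N, rlIntegral a j (fun _ => c j) x + rlIntegral a α g x

theorem fracTaylor_succ (a : ℝ) (N : ℕ) (c : ℕ → ℝ) (α : ℝ) (g : ℝ → ℝ) :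
    fracTaylor a (N + 1) c α g =
      fun x => fracTaylor a N c α g x + rlIntegral a N (fun _ => c N) x := by
  funext x
  simp only [fracTaylor, Finset.sum_range_succ, add_right_comm]

theorem fracTaylor_congr_coeff {N : ℕ} (h : ∀ j < N, c j = d j) (a α : ℝ) (g : ℝ → ℝ) :
    fracTaylor a N c α g = fracTaylor a N d α g := by
  funext x
  simp only [fracTaylor]
  congr 1
  exact Finset.sum_congr rfl fun j hj => by rw [h j (Finset.mem_range.1 hj)]

theorem fracTaylor_congr (h : EqOn f g (Icc a b)) (N : ℕ) (c : ℕ → ℝ) (α : ℝ) :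
    EqOn (fracTaylor a N c α f) (fracTaylor a N c α g) (Icc a b) := fun x hx => by
  simp only [fracTaylor, rlIntegral_congr h α hx]

theorem fracTaylor_zero_coeff (a : ℝ) (N : ℕ) (α : ℝ) (g : ℝ → ℝ) :
    fracTaylor a N 0 α g = rlIntegral a α g := by
  funext x
  simp [fracTaylor, rlIntegral_natCast_const]

theorem fracTaylor_self {N : ℕ} (hN : N ≠ 0) (hα : α ≠ 0) (a : ℝ) (c : ℕ → ℝ) (g : ℝ → ℝ) :
    fracTaylor a N c α g a = c 0 := by
  obtain ⟨N, rfl⟩ := Nat.exists_eq_succ_of_ne_zero hN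
  simp [fracTaylor, rlIntegral_self hα, Finset.sum_range_succ', rlIntegral_natCast_const]

theorem continuousOn_fracTaylor (hα : 0 ≤ α) (N : ℕ) (c : ℕ → ℝ) (hg : ContinuousOn g (Icc a b)) :
    ContinuousOn (fracTaylor a N c α g) (Icc a b) :=
  (continuousOn_finsetSum _ fun j _ =>
    continuousOn_rlIntegral j.cast_nonneg continuousOn_const).add (continuousOn_rlIntegral hα hg)

theorem rlIntegral_fracTaylor (hα : 0 ≤ α) (hβ : 0 ≤ β) (N : ℕ) (c : ℕ → ℝ)
    (hg : ContinuousOn g (Icc a b)) (hx : x ∈ Icc a b) :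
    rlIntegral a β (fracTaylor a N c α g) x =
      ∑ j ∈ Finset.range N, rlIntegral a (β + j) (fun _ => c j) x + rlIntegral a (β + α) g x := by
  induction N with
  | zero =>
    have hzero : fracTaylor a 0 c α g = rlIntegral a α g := funext fun _ => by simp [fracTaylor]
    simpa [hzero] using rlIntegral_rlIntegral hβ hα hg hx
  | succ N ih =>
    rw [fracTaylor_succ, rlIntegral_add hβ (continuousOn_fracTaylor hα N c hg)
      (continuousOn_rlIntegral N.cast_nonneg continuousOn_const) hx, ih,
      rlIntegral_rlIntegral hβ N.cast_nonneg continuousOn_const hx, Finset.sum_range_succ,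
      add_right_comm]

theorem fracTaylor_rlIntegral (hα : 0 ≤ α) (hβ : 0 ≤ β) (N : ℕ) (c : ℕ → ℝ)
    (hg : ContinuousOn g (Icc a b)) :
    EqOn (fracTaylor a N c α (rlIntegral a β g)) (fracTaylor a N c (α + β) g) (Icc a b) :=
  fun x hx => by simp only [fracTaylor, rlIntegral_rlIntegral hα hβ hg hx]

theorem fracTaylor_fracTaylor (hα : 0 ≤ α) (n N : ℕ) (c : ℕ → ℝ)
    (hg : ContinuousOn g (Icc a b)) :
    EqOn (fracTaylor a n c n (fracTaylor a N (fun j => c (n + j)) α g))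
      (fracTaylor a (n + N) c (n + α) g) (Icc a b) := fun x hx => by
  rw [fracTaylor, rlIntegral_fracTaylor hα n.cast_nonneg N _ hg hx, fracTaylor,
    Finset.sum_range_add, add_assoc]
  simp only [Nat.cast_add]

theorem hasDerivWithinAt_fracTaylor (hα : 0 ≤ α) (N : ℕ) (c : ℕ → ℝ)
    (hg : ContinuousOn g (Icc a b)) (hx : x ∈ Icc a b) :
    HasDerivWithinAt (fracTaylor a (N + 1) c (α + 1) g)
      (fracTaylor a N (fun j => c (j + 1)) α g x) (Icc a b) x := by
  have hsum : HasDerivWithinAt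
      (fun x => ∑ j ∈ Finset.range (N + 1), rlIntegral a j (fun _ => c j) x)
      (∑ j ∈ Finset.range N, rlIntegral a j (fun _ => c (j + 1)) x) (Icc a b) x := by
    simp only [Finset.sum_range_succ' _ N, Nat.cast_zero, rlIntegral_zero]
    refine (HasDerivWithinAt.fun_sum fun j _ => ?_).add_const _
    rw [Nat.cast_add_one]
    exact hasDerivWithinAt_rlIntegral_add_one j.cast_nonneg continuousOn_const hx
  exact hsum.add (hasDerivWithinAt_rlIntegral_add_one hα hg hx)

theorem derivWithin_fracTaylor (hab : a < b) (hα : 0 ≤ α) (N : ℕ) (c : ℕ → ℝ)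
    (hg : ContinuousOn g (Icc a b)) :
    EqOn (derivWithin (fracTaylor a (N + 1) c (α + 1) g) (Icc a b))
      (fracTaylor a N (fun j => c (j + 1)) α g) (Icc a b) :=
  fun x hx => (hasDerivWithinAt_fracTaylor hα N c hg hx).derivWithin (uniqueDiffOn_Icc hab x hx)

theorem iteratedDerivWithin_fracTaylor (hab : a < b) (hα : 0 ≤ α) (N k : ℕ) (c : ℕ → ℝ)
    (hg : ContinuousOn g (Icc a b)) :
    EqOn (iteratedDerivWithin k (fracTaylor a (N + k) c (α + k) g) (Icc a b))
      (fracTaylor a N (fun j => c (j + k)) α g) (Icc a b) := by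
  induction k generalizing N α with
  | zero =>
    intro x _
    simp
  | succ k ih =>
    have hk := ih (add_nonneg hα zero_le_one) (N + 1)
    rw [add_assoc, add_assoc, add_comm 1 k, add_comm 1 (k : ℝ), ← Nat.cast_add_one] at hk
    intro x hx
    rw [iteratedDerivWithin_succ, derivWithin_congr hk (hk hx),
      derivWithin_fracTaylor hab hα N _ hg hx]
    simp only [add_assoc, add_comm 1 k]

theorem contDiffOn_fracTaylor (hab : a < b) (hα : 0 ≤ α) (N n : ℕ) (c : ℕ → ℝ)
    (hg : ContinuousOn g (Icc a b)) :
    ContDiffOn ℝ n (fracTaylor a (N + n) c (α + n) g) (Icc a b) := by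
  induction n generalizing c with
  | zero => simpa using continuousOn_fracTaylor hα N c hg
  | succ n ih =>
    have hαn : 0 ≤ α + n := add_nonneg hα n.cast_nonneg
    rw [Nat.cast_add_one, Nat.cast_add_one, ← add_assoc, ← add_assoc,
      contDiffOn_succ_iff_derivWithin (uniqueDiffOn_Icc hab)]
    exact ⟨fun x hx => (hasDerivWithinAt_fracTaylor hαn _ c hg hx).differentiableWithinAt,
      by simp, (ih _).congr (derivWithin_fracTaylor hab hαn _ c hg)⟩

theorem iteratedDerivWithin_fracTaylor_left (hab : a < b) {N k : ℕ} (hkN : k < N) (hkα : k < α)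
    (c : ℕ → ℝ) (hg : ContinuousOn g (Icc a b)) :
    iteratedDerivWithin k (fracTaylor a N c α g) (Icc a b) a = c k := by
  have h := iteratedDerivWithin_fracTaylor hab (sub_nonneg.2 hkα.le) (N - k) k c hg
    (left_mem_Icc.2 hab.le)
  rw [Nat.sub_add_cancel hkN.le, sub_add_cancel] at h
  rw [h, fracTaylor_self (Nat.sub_ne_zero_of_lt hkN) (sub_pos.2 hkα).ne', zero_add]

theorem iteratedDerivWithin_rlIntegral (hab : a < b) (hα : 0 ≤ α) (k : ℕ)
    (hg : ContinuousOn g (Icc a b)) :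
    EqOn (iteratedDerivWithin k (rlIntegral a (α + k) g) (Icc a b)) (rlIntegral a α g)
      (Icc a b) := by
  have h := iteratedDerivWithin_fracTaylor hab hα 0 k 0 hg
  rwa [fracTaylor_zero_coeff, show (fun j => (0 : ℕ → ℝ) (j + k)) = 0 from rfl,
    fracTaylor_zero_coeff] at h

theorem contDiffOn_rlIntegral_natCast (hab : a < b) (n : ℕ) (hg : ContinuousOn g (Icc a b)) :
    ContDiffOn ℝ n (rlIntegral a n g) (Icc a b) := by
  simpa only [fracTaylor_zero_coeff, zero_add] using contDiffOn_fracTaylor hab le_rfl 0 n 0 hg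

theorem iteratedDerivWithin_rlIntegral_natCast (hab : a < b) (n : ℕ)
    (hg : ContinuousOn g (Icc a b)) :
    EqOn (iteratedDerivWithin n (rlIntegral a n g) (Icc a b)) g (Icc a b) := by
  simpa only [zero_add, rlIntegral_zero] using iteratedDerivWithin_rlIntegral hab le_rfl n hg

theorem eqOn_of_eqOn_rlIntegral (hab : a < b) (hα : 0 ≤ α) (hf : ContinuousOn f (Icc a b))
    (hg : ContinuousOn g (Icc a b)) (h : EqOn (rlIntegral a α f) (rlIntegral a α g) (Icc a b)) :
    EqOn f g (Icc a b) := by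
  -- `J_a^{⌈α⌉-α}` turns `J_a^α` into `J_a^{⌈α⌉}`, which differentiating `⌈α⌉` times inverts.
  have hceil : EqOn (rlIntegral a ⌈α⌉₊ f) (rlIntegral a ⌈α⌉₊ g) (Icc a b) := by
    have hnonneg : 0 ≤ (⌈α⌉₊ : ℝ) - α := sub_nonneg.2 (Nat.le_ceil α)
    intro x hx
    have hfg := rlIntegral_congr h (⌈α⌉₊ - α) hx
    rwa [rlIntegral_rlIntegral hnonneg hα hf hx, rlIntegral_rlIntegral hnonneg hα hg hx,
      sub_add_cancel] at hfg
  exact (iteratedDerivWithin_rlIntegral_natCast hab _ hf).symm.trans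
    ((iteratedDerivWithin_congr hceil).trans (iteratedDerivWithin_rlIntegral_natCast hab _ hg))

theorem eqOn_fracTaylor_of_contDiffOn (hab : a < b) {n : ℕ} (hf : ContDiffOn ℝ n f (Icc a b)) :
    EqOn f (fracTaylor a n (fun k => iteratedDerivWithin k f (Icc a b) a) n
      (iteratedDerivWithin n f (Icc a b))) (Icc a b) := by
  induction n generalizing f with
  | zero =>
    intro x _
    simp [fracTaylor, rlIntegral_zero]
  | succ n ih =>
    have hcont : ContinuousOn (iteratedDerivWithin (n + 1) f (Icc a b)) (Icc a b) :=
      hf.continuousOn_iteratedDerivWithin le_rfl (uniqueDiffOn_Icc hab)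
    rw [Nat.cast_add_one] at hf ⊢
    obtain ⟨hdiff, -, hf'⟩ := (contDiffOn_succ_iff_derivWithin (uniqueDiffOn_Icc hab)).1 hf
    have hderiv := derivWithin_fracTaylor hab n.cast_nonneg n
      (fun k => iteratedDerivWithin k f (Icc a b) a) hcont
    refine eq_of_derivWithin_eq hdiff (fun x hx =>
      (hasDerivWithinAt_fracTaylor n.cast_nonneg n _ hcont hx).differentiableWithinAt)
      (fun x hx => ?_) ?_
    · rw [hderiv (Ico_subset_Icc_self hx), ih hf' (Ico_subset_Icc_self hx)]
      simp only [iteratedDerivWithin_succ']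
    · rw [fracTaylor_self n.succ_ne_zero n.cast_add_one_ne_zero, iteratedDerivWithin_zero]

end FracTaylor

section Caputo

variable {a b α β γ : ℝ} {f g h : ℝ → ℝ}

theorem taylorWithinEval_eq_sum_rlIntegral (f : ℝ → ℝ) (n : ℕ) (s : Set ℝ) (a x : ℝ) :
    taylorWithinEval f n s a x =
      ∑ k ∈ Finset.range (n + 1), rlIntegral a k (fun _ => iteratedDerivWithin k f s a) x := by
  rw [taylor_within_apply]
  refine Finset.sum_congr rfl fun k _ => ?_
  rw [rlIntegral_natCast_const, smul_eq_mul]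
  ring

theorem caputoRemainder_eq_sub_sum (hα : 0 < α) (a b : ℝ) (f : ℝ → ℝ) (x : ℝ) :
    caputoRemainder a b α f x = f x - ∑ k ∈ Finset.range ⌈α⌉₊,
      rlIntegral a k (fun _ => iteratedDerivWithin k f (Icc a b) a) x := by
  rw [caputoRemainder, taylorWithinEval_eq_sum_rlIntegral,
    Nat.sub_add_cancel (Nat.one_le_ceil_iff.2 hα)]

theorem sub_taylorWithinEval_eqOn_rlIntegral (hab : a < b) {n : ℕ}
    (hf : ContDiffOn ℝ n f (Icc a b)) :
    EqOn (fun x => f x - taylorWithinEval f n (Icc a b) a x)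
      (rlIntegral a n fun x =>
        iteratedDerivWithin n f (Icc a b) x - iteratedDerivWithin n f (Icc a b) a) (Icc a b) := by
  intro x hx
  have hcont := hf.continuousOn_iteratedDerivWithin le_rfl (uniqueDiffOn_Icc hab)
  have hsplit := rlIntegral_add n.cast_nonneg
    (hcont.sub (continuousOn_const (c := iteratedDerivWithin n f (Icc a b) a)))
    (continuousOn_const (c := iteratedDerivWithin n f (Icc a b) a)) hx
  simp only [Pi.sub_apply, sub_add_cancel] at hsplit
  have htaylor := eqOn_fracTaylor_of_contDiffOn hab hf hx
  rw [fracTaylor, hsplit] at htaylor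
  simp only [taylorWithinEval_eq_sum_rlIntegral, Finset.sum_range_succ]
  linear_combination htaylor

theorem iteratedDerivWithin_rlIntegral_left (hab : a < b) {k : ℕ} (hk : k ≤ α)
    (hg : ContinuousOn g (Icc a b)) (hga : g a = 0) :
    iteratedDerivWithin k (rlIntegral a α g) (Icc a b) a = 0 := by
  have h := iteratedDerivWithin_rlIntegral hab (sub_nonneg.2 hk) k hg (left_mem_Icc.2 hab.le)
  rwa [sub_add_cancel, rlIntegral_self_of_eq_zero hga] at h

theorem eqOn_rlIntegral_of_contDiffOn (hab : a < b) {n : ℕ} (hf : ContDiffOn ℝ n f (Icc a b))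
    (hfa : ∀ k < n, iteratedDerivWithin k f (Icc a b) a = 0) :
    EqOn f (rlIntegral a n (iteratedDerivWithin n f (Icc a b))) (Icc a b) := by
  have h := eqOn_fracTaylor_of_contDiffOn hab hf
  rwa [fracTaylor_congr_coeff (d := 0) hfa, fracTaylor_zero_coeff] at h

/-- `g` is continuous on `[a,b]` and is the Caputo derivative of order `α ≥ 0` of `f` there,
expressed through the representation `f = ∑_{j<⌈α⌉} c_j (x-a)^j / j! + J_a^α g` instead of
derivatives. -/
def HasCaputoDerivOn (a b α : ℝ) (f g : ℝ → ℝ) : Prop :=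
  ContinuousOn g (Icc a b) ∧ ∃ c, EqOn f (fracTaylor a ⌈α⌉₊ c α g) (Icc a b)

theorem HasCaputoDerivOn.caputoRemainder_eqOn (hab : a < b) (hα : 0 < α)
    (h : HasCaputoDerivOn a b α f g) :
    EqOn (caputoRemainder a b α f) (rlIntegral a α g) (Icc a b) := by
  obtain ⟨hg, c, hf⟩ := h
  intro x hx
  have hcoeff (k : ℕ) (hk : k < ⌈α⌉₊) : iteratedDerivWithin k f (Icc a b) a = c k :=
    (iteratedDerivWithin_congr hf (left_mem_Icc.2 hab.le)).trans
      (iteratedDerivWithin_fracTaylor_left hab hk (Nat.lt_ceil.1 hk) c hg)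
  rw [caputoRemainder_eq_sub_sum hα, hf hx, ← fracTaylor_congr_coeff hcoeff, fracTaylor,
    add_sub_cancel_left]

theorem HasCaputoDerivOn.rlIntegral_caputoRemainder_eqOn (hab : a < b) (hα : 0 < α)
    (h : HasCaputoDerivOn a b α f g) :
    EqOn (rlIntegral a (⌈α⌉₊ - α) (caputoRemainder a b α f)) (rlIntegral a ⌈α⌉₊ g)
      (Icc a b) := by
  intro x hx
  rw [rlIntegral_congr (h.caputoRemainder_eqOn hab hα) _ hx,
    rlIntegral_rlIntegral (sub_nonneg.2 (Nat.le_ceil α)) hα.le h.1 hx, sub_add_cancel]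

theorem HasCaputoDerivOn.contDiffOn (hab : a < b) (hα : 0 < α) (h : HasCaputoDerivOn a b α f g) :
    ContDiffOn ℝ (⌈α⌉₊ - 1 : ℕ) f (Icc a b) := by
  obtain ⟨hg, c, hf⟩ := h
  have hpos : 1 ≤ ⌈α⌉₊ := Nat.one_le_ceil_iff.2 hα
  have hlt : ((⌈α⌉₊ - 1 : ℕ) : ℝ) < α := Nat.lt_ceil.1 (Nat.sub_one_lt_of_lt hpos)
  have hdiff := contDiffOn_fracTaylor hab (sub_nonneg.2 hlt.le) 1 (⌈α⌉₊ - 1) c hg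
  rw [sub_add_cancel, Nat.add_sub_cancel' hpos] at hdiff
  exact hdiff.congr hf

theorem HasCaputoDerivOn.contCaputoDifferentiable (hab : a < b) (hα : 0 < α)
    (h : HasCaputoDerivOn a b α f g) : ContCaputoDifferentiable a b α f :=
  ⟨h.contDiffOn hab hα,
    (continuousOn_rlIntegral hα.le h.1).congr (h.caputoRemainder_eqOn hab hα),
    (contDiffOn_rlIntegral_natCast hab _ h.1).congr (h.rlIntegral_caputoRemainder_eqOn hab hα)⟩

theorem HasCaputoDerivOn.caputoDeriv_eqOn (hab : a < b) (hα : 0 < α)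
    (h : HasCaputoDerivOn a b α f g) : EqOn (caputoDeriv a b α f) g (Icc a b) := by
  rw [caputoDeriv, if_neg hα.ne', rlDeriv]
  exact (iteratedDerivWithin_congr (h.rlIntegral_caputoRemainder_eqOn hab hα)).trans
    (iteratedDerivWithin_rlIntegral_natCast hab _ h.1)

theorem iteratedDerivWithin_rlIntegral_caputoRemainder_left (hab : a < b)
    (hf : ContDiffOn ℝ (⌈α⌉₊ - 1 : ℕ) f (Icc a b)) {k : ℕ} (hk : k < ⌈α⌉₊) :
    iteratedDerivWithin k (rlIntegral a (⌈α⌉₊ - α) (caputoRemainder a b α f)) (Icc a b) a = 0 := by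
  set n := ⌈α⌉₊ - 1
  set s : ℝ → ℝ := fun x =>
    iteratedDerivWithin n f (Icc a b) x - iteratedDerivWithin n f (Icc a b) a
  have hcont : ContinuousOn s (Icc a b) :=
    (hf.continuousOn_iteratedDerivWithin le_rfl (uniqueDiffOn_Icc hab)).sub continuousOn_const
  have hnonneg : 0 ≤ (⌈α⌉₊ : ℝ) - α := sub_nonneg.2 (Nat.le_ceil α)
  have hrepr : EqOn (rlIntegral a (⌈α⌉₊ - α) (caputoRemainder a b α f))
      (rlIntegral a (⌈α⌉₊ - α + n) s) (Icc a b) :=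
    (rlIntegral_congr (sub_taylorWithinEval_eqOn_rlIntegral hab hf) _).trans
      (rlIntegral_rlIntegral hnonneg n.cast_nonneg hcont)
  have hkn : (k : ℝ) ≤ ⌈α⌉₊ - α + n :=
    (Nat.cast_le.2 (Nat.le_sub_one_of_lt hk)).trans (le_add_of_nonneg_left hnonneg)
  rw [iteratedDerivWithin_congr hrepr (left_mem_Icc.2 hab.le),
    iteratedDerivWithin_rlIntegral_left hab hkn hcont (sub_self _)]

theorem ContCaputoDifferentiable.hasCaputoDerivOn (hab : a < b) (hα : 0 < α)
    (hf : ContCaputoDifferentiable a b α f) :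
    HasCaputoDerivOn a b α f (caputoDeriv a b α f) := by
  obtain ⟨hfn, hrcont, hrdiff⟩ := hf
  have hnonneg : 0 ≤ (⌈α⌉₊ : ℝ) - α := sub_nonneg.2 (Nat.le_ceil α)
  rw [caputoDeriv, if_neg hα.ne', rlDeriv]
  have hcont := hrdiff.continuousOn_iteratedDerivWithin le_rfl (uniqueDiffOn_Icc hab)
  have hrepr := eqOn_rlIntegral_of_contDiffOn hab hrdiff fun k hk =>
    iteratedDerivWithin_rlIntegral_caputoRemainder_left hab hfn hk
  have hrem := eqOn_of_eqOn_rlIntegral hab hnonneg hrcont (continuousOn_rlIntegral hα.le hcont)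
    (hrepr.trans fun x hx => by rw [rlIntegral_rlIntegral hnonneg hα.le hcont hx, sub_add_cancel])
  refine ⟨hcont, fun k => iteratedDerivWithin k f (Icc a b) a, fun x hx => ?_⟩
  rw [fracTaylor, ← hrem hx, caputoRemainder_eq_sub_sum hα, add_sub_cancel]

theorem HasCaputoDerivOn.congr (hf : HasCaputoDerivOn a b α f g) (hfh : EqOn h f (Icc a b)) :
    HasCaputoDerivOn a b α h g :=
  ⟨hf.1, hf.2.imp fun _ hc => hfh.trans hc⟩

theorem hasCaputoDerivOn_natCast_add_iff (n : ℕ) (hγ : 0 ≤ γ) :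
    HasCaputoDerivOn a b (n + γ) f g ↔
      ∃ h, HasCaputoDerivOn a b n f h ∧ HasCaputoDerivOn a b γ h g := by
  have hceil : ⌈(n : ℝ) + γ⌉₊ = n + ⌈γ⌉₊ := by
    rw [add_comm, Nat.ceil_add_natCast hγ, add_comm]
  constructor
  · rintro ⟨hg, c, hf⟩
    rw [hceil] at hf
    refine ⟨fracTaylor a ⌈γ⌉₊ (fun j => c (n + j)) γ g,
      ⟨continuousOn_fracTaylor hγ _ _ hg, c, ?_⟩, hg, _, fun _ _ => rfl⟩
    rw [Nat.ceil_natCast]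
    exact hf.trans (fracTaylor_fracTaylor hγ n _ c hg).symm
  · rintro ⟨h, ⟨-, c, hf⟩, hg, d, hh⟩
    rw [Nat.ceil_natCast] at hf
    set e : ℕ → ℝ := fun j => if j < n then c j else d (j - n) with he
    have hce : ∀ j < n, c j = e j := fun j hj => by simp [he, hj]
    have hde : d = fun j => e (n + j) := funext fun j => by simp [he]
    refine ⟨hg, e, fun x hx => ?_⟩
    rw [hceil, ← fracTaylor_fracTaylor hγ n _ e hg hx, ← hde, hf hx, fracTaylor_congr hh _ _ _ hx,
      fracTaylor_congr_coeff hce]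

theorem hasCaputoDerivOn_add_iff_of_ceil_eq (hβ : 0 ≤ β) (hγ : 0 ≤ γ)
    (hceil : ⌈β + γ⌉₊ = ⌈β⌉₊) (hg : ContinuousOn g (Icc a b)) :
    HasCaputoDerivOn a b (β + γ) f g ↔ HasCaputoDerivOn a b β f (rlIntegral a γ g) := by
  have hrepr (c : ℕ → ℝ) : EqOn f (fracTaylor a ⌈β + γ⌉₊ c (β + γ) g) (Icc a b) ↔
      EqOn f (fracTaylor a ⌈β⌉₊ c β (rlIntegral a γ g)) (Icc a b) := by
    have h := fracTaylor_rlIntegral hβ hγ ⌈β⌉₊ c hg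
    rw [hceil]
    exact ⟨fun hf => hf.trans h.symm, fun hf => hf.trans h⟩
  simp only [HasCaputoDerivOn, hrepr, hg, continuousOn_rlIntegral hγ hg, true_and]

theorem hasCaputoDerivOn_and_left_eq_zero_iff (hab : a ≤ b) (hγ : 0 < γ) (hγ1 : γ ≤ 1) :
    HasCaputoDerivOn a b γ h g ∧ h a = 0 ↔
      ContinuousOn g (Icc a b) ∧ EqOn h (rlIntegral a γ g) (Icc a b) := by
  have ha : a ∈ Icc a b := left_mem_Icc.2 hab
  have hceil : ⌈γ⌉₊ = 1 := (Nat.ceil_eq_iff one_ne_zero).2 (by simpa using ⟨hγ, hγ1⟩)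
  constructor
  · rintro ⟨⟨hg, c, hh⟩, hha⟩
    rw [hceil] at hh
    rw [hh ha, fracTaylor_self one_ne_zero hγ.ne'] at hha
    rw [fracTaylor_congr_coeff (d := 0) (by simpa using hha), fracTaylor_zero_coeff] at hh
    exact ⟨hg, hh⟩
  · rintro ⟨hg, hh⟩
    exact ⟨⟨hg, 0, by rwa [fracTaylor_zero_coeff]⟩, (hh ha).trans (rlIntegral_self hγ.ne' a g)⟩

theorem hasCaputoDerivOn_add_iff (hab : a ≤ b) (hβ : 0 ≤ β) (hγ : 0 < γ)
    (hβγ : (∃ n : ℕ, β = n) ∨ ⌈β + γ⌉₊ = ⌈β⌉₊) :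
    HasCaputoDerivOn a b (β + γ) f g ↔ ∃ h, HasCaputoDerivOn a b β f h ∧
      HasCaputoDerivOn a b γ h g ∧ ((¬ ∃ n : ℕ, β = n) → h a = 0) := by
  by_cases hn : ∃ n : ℕ, β = n
  · simp only [hn, not_true_eq_false, false_imp_iff, and_true]
    obtain ⟨n, rfl⟩ := hn
    exact hasCaputoDerivOn_natCast_add_iff n hγ.le
  have hceil := hβγ.resolve_left hn
  have hγ1 : γ ≤ 1 := by
    have hle : β + γ ≤ ⌈β⌉₊ := hceil ▸ Nat.le_ceil (β + γ)
    linarith [Nat.ceil_lt_add_one hβ]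
  simp only [hn, not_false_eq_true, true_imp_iff,
    hasCaputoDerivOn_and_left_eq_zero_iff hab hγ hγ1]
  constructor
  · intro hf
    exact ⟨rlIntegral a γ g, (hasCaputoDerivOn_add_iff_of_ceil_eq hβ hγ.le hceil hf.1).1 hf, hf.1,
      fun _ _ => rfl⟩
  · rintro ⟨h, ⟨-, c, hf⟩, hg, hh⟩
    exact (hasCaputoDerivOn_add_iff_of_ceil_eq hβ hγ.le hceil hg).2
      ⟨continuousOn_rlIntegral hγ.le hg, c, hf.trans (fracTaylor_congr hh _ _ _)⟩

theorem HasCaputoDerivOn.exists_of_lt (hab : a ≤ b) (hβ : 0 ≤ β) (hβα : β < α)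
    (hf : HasCaputoDerivOn a b α f g) :
    ∃ h, HasCaputoDerivOn a b β f h ∧ ((¬ ∃ n : ℕ, β = n) → h a = 0) := by
  obtain ⟨δ, k, hβδ, hδ, hk⟩ : ∃ δ k, β < δ ∧ ((∃ n : ℕ, β = n) ∨ ⌈δ⌉₊ = ⌈β⌉₊) ∧
      HasCaputoDerivOn a b δ f k := by
    by_cases hn : ∃ n : ℕ, β = n
    · exact ⟨α, g, hβα, .inl hn, hf⟩
    rcases (Nat.ceil_mono hβα.le).eq_or_lt with hceil | hceil
    · exact ⟨α, g, hβα, .inr hceil.symm, hf⟩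
    have hlt : (⌈β⌉₊ : ℝ) < α := Nat.lt_ceil.1 hceil
    rw [← add_sub_cancel (⌈β⌉₊ : ℝ) α, hasCaputoDerivOn_natCast_add_iff _ (sub_pos.2 hlt).le] at hf
    obtain ⟨k, hk, -⟩ := hf
    exact ⟨⌈β⌉₊, k, (Nat.le_ceil β).lt_of_ne fun h => hn ⟨_, h⟩, .inr (Nat.ceil_natCast _), hk⟩
  rw [← add_sub_cancel β δ] at hδ hk
  obtain ⟨h, hh, -, hha⟩ := (hasCaputoDerivOn_add_iff hab hβ (sub_pos.2 hβδ) hδ).1 hk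
  exact ⟨h, hh, hha⟩

theorem exists_natCast_eq_or_ceil_add_eq (hβ : 0 < β) (hγ : 0 < γ)
    (h : ⌈β + γ⌉ - ⌊β⌋ = 1) : (∃ n : ℕ, β = n) ∨ ⌈β + γ⌉₊ = ⌈β⌉₊ := by
  by_cases hfloor : (⌊β⌋ : ℝ) = β
  · exact .inl ⟨⌊β⌋₊, by rw [natCast_floor_eq_intCast_floor hβ.le, hfloor]⟩
  have hlt : ⌊β⌋ < ⌈β⌉ := Int.lt_ceil.2 ((Int.floor_le β).lt_of_ne hfloor)
  have hle : ⌈β⌉ ≤ ⌈β + γ⌉ := Int.ceil_mono (le_add_of_nonneg_right hγ.le)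
  exact .inr (by rw [← Int.ceil_toNat, ← Int.ceil_toNat, show ⌈β + γ⌉ = ⌈β⌉ by omega])

end Caputo

theorem theorem3p5_general (a b : ℝ) (hab : a < b) :
    (∀ (α β : ℝ) (f : ℝ → ℝ), ContCaputoDifferentiable a b α f → 0 < β → β < α →
        (ContCaputoDifferentiable a b β f ∧
          ContinuousOn (caputoDeriv a b β f) (Icc a b) ∧
          ((¬ ∃ n : ℕ, β = n) → caputoDeriv a b β f a = 0)) ∧
        (∀ γ : ℝ, 0 < γ → β + γ ≤ α → ((∃ n : ℕ, β = n) ∨ ⌈β + γ⌉₊ = ⌈β⌉₊) →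
          ContCaputoDifferentiable a b γ (caputoDeriv a b β f) ∧
          EqOn (caputoDeriv a b γ (caputoDeriv a b β f)) (caputoDeriv a b (β + γ) f)
            (Icc a b))) ∧
    (∀ (β γ : ℝ) (h : ℝ → ℝ), 0 < β → 0 < γ → ((∃ n : ℕ, β = n) ∨ ⌈β + γ⌉₊ = ⌈β⌉₊) →
      ContCaputoDifferentiable a b β h →
      ContCaputoDifferentiable a b γ (caputoDeriv a b β h) →
      ((¬ ∃ n : ℕ, β = n) → caputoDeriv a b β h a = 0) →
        ContCaputoDifferentiable a b (β + γ) h ∧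
        EqOn (caputoDeriv a b γ (caputoDeriv a b β h)) (caputoDeriv a b (β + γ) h)
          (Icc a b)) := by
  refine ⟨fun α β f hf hβ hβα => ?_, fun β γ h hβ hγ hβγ hh hh' hha => ?_⟩
  · have hα := hf.hasCaputoDerivOn hab (hβ.trans hβα)
    obtain ⟨f₁, hf₁, hf₁a⟩ := hα.exists_of_lt hab.le hβ.le hβα
    have heq := hf₁.caputoDeriv_eqOn hab hβ
    refine ⟨⟨hf₁.contCaputoDifferentiable hab hβ, hf₁.1.congr heq,
      fun hn => (heq (left_mem_Icc.2 hab.le)).trans (hf₁a hn)⟩, fun γ hγ hγα hβγ => ?_⟩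
    have hsum : HasCaputoDerivOn a b (β + γ) f (caputoDeriv a b (β + γ) f) := by
      rcases hγα.eq_or_lt with rfl | hlt
      · exact hα
      · obtain ⟨_, hf₂, -⟩ := hα.exists_of_lt hab.le (add_pos hβ hγ).le hlt
        exact (hf₂.contCaputoDifferentiable hab (add_pos hβ hγ)).hasCaputoDerivOn hab
          (add_pos hβ hγ)
    obtain ⟨f₂, hf₂, hf₂γ, -⟩ := (hasCaputoDerivOn_add_iff hab.le hβ.le hγ hβγ).1 hsum
    have hγderiv := hf₂γ.congr (hf₂.caputoDeriv_eqOn hab hβ)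
    exact ⟨hγderiv.contCaputoDifferentiable hab hγ, hγderiv.caputoDeriv_eqOn hab hγ⟩
  · have hsum := (hasCaputoDerivOn_add_iff hab.le hβ.le hγ hβγ).2
      ⟨_, hh.hasCaputoDerivOn hab hβ, hh'.hasCaputoDerivOn hab hγ, hha⟩
    exact ⟨hsum.contCaputoDifferentiable hab (add_pos hβ hγ),
      (hsum.caputoDeriv_eqOn hab (add_pos hβ hγ)).symm⟩

theorem theorem3p5 (a b : ℝ) (hab : a < b) :
    (∀ (α : ℝ) (f : ℝ → ℝ), 0 < α → ContCaputoDifferentiable a b α f →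
      ∀ β : ℝ, 0 < β → β < α →
        (ContCaputoDifferentiable a b β f ∧
          ContinuousOn (caputoDeriv a b β f) (Set.Icc a b) ∧
          ((¬ ∃ n : ℕ, β = n) → caputoDeriv a b β f a = 0)) ∧
        (∀ γ : ℝ, 0 < γ → γ ≤ 1 → β + γ ≤ α → ⌈β + γ⌉ - ⌊β⌋ = 1 →
          ContCaputoDifferentiable a b γ (caputoDeriv a b β f) ∧
          Set.EqOn (caputoDeriv a b γ (caputoDeriv a b β f)) (caputoDeriv a b (β + γ) f)
            (Set.Icc a b))) ∧
    (∀ (β γ : ℝ) (h : ℝ → ℝ), 0 < β → 0 < γ → γ ≤ 1 → ⌈β + γ⌉ - ⌊β⌋ = 1 →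
      ContCaputoDifferentiable a b β h →
      ContCaputoDifferentiable a b γ (caputoDeriv a b β h) →
      ((¬ ∃ n : ℕ, β = n) → caputoDeriv a b β h a = 0) →
        ContCaputoDifferentiable a b (β + γ) h ∧
        Set.EqOn (caputoDeriv a b γ (caputoDeriv a b β h)) (caputoDeriv a b (β + γ) h)
          (Set.Icc a b)) := by
  obtain ⟨h₁, h₂⟩ := theorem3p5_general a b hab
  refine ⟨fun α f _ hf β hβ hβα => ?_, fun β γ h hβ hγ _ hβγ => ?_⟩
  · obtain ⟨hfβ, hcomp⟩ := h₁ α β f hf hβ hβα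
    exact ⟨hfβ, fun γ hγ _ hγα hβγ =>
      hcomp γ hγ hγα (exists_natCast_eq_or_ceil_add_eq hβ hγ hβγ)⟩
  · exact h₂ β γ h hβ hγ (exists_natCast_eq_or_ceil_add_eq hβ hγ hβγ)
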